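/- **Theorem 2.1** (Faber–Krahn type lower bounds). Let $d\in\{2,3\}$ and let $D\subset\mathbb{R}^d$ be a bounded simply connected open set whose boundary is either of class $C^2$ or polygonal (polyhedral) with no reentrant corners, i.e. in the latter case $D$ is the interior of a convex polytope; let $\nu$ be the outward unit normal. Put $X(D)=H^2(D)\cap H^1_0(D)$ (complex-valued functions). Let $n:D\to\mathbb{R}$ and $\eta:\partial D\to\mathbb{R}$ be measurable, with constants such that $$n_{\min}\le n\le n_{\max}\ \text{ a.e. in } D,\qquad 0<\eta_{\min}\le\eta\le\eta_{\max}\ \text{ a.e. on }\partial D .$$ Let $$\lambda_1=\min_{\varphi\in X(D)\setminus\{0\}}\frac{\|\Delta\varphi\|^2_{L^2(D)}}{\|\nabla\varphi\|^2_{L^2(D)}}$$ be the first simply supported plate buckling eigenvalue of $D$ (the smallest $\lambda>0$ for which $\Delta^2\psi=-\lambda\Delta\psi$ in $D$, $\Delta\psi=0$ on $\partial D$, has a nontrivial solution $\psi\in X(D)$). Let $k\in\mathbb{R}$ be a real transmission eigenvalue with conductive boundary condition, i.e. there is a nontrivial $u\in X(D)$ with $$(\Delta+k^2)\,\frac{1}{n-1}\,(\Delta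 u+k^2nu)=0\ \text{ in } D,\qquad -\frac{k^2}{\eta}\,\partial_\nu u=\frac{1}{n-1}\,(\Delta u+k^2nu)\ \text{ on }\partial D,$$ the first equation in the sense of distributions, and the trace of $g=\frac{1}{n-1}(\Delta u+k^2nu)$ being defined by duality through Green's second identity, $\int_D (g\,\Delta\overline\varphi-\overline\varphi\,\Delta g)\,dx=\int_{\partial D}g\,\partial_\nu\overline\varphi\,ds$ for all $\varphi\in X(D)$. Then: 1. if $n_{\min}>1$, then $\displaystyle k^2\ge\frac{\lambda_1}{n_{\max}}$; 2. if $0\le n_{\min}$ and $n_{\max}<1$, then $\displaystyle k^2\ge\frac{\lambda_1\,\eta_{\min}}{\eta_{\min}+C_T\,\lambda_1}$ for every constant $C_T$ such that $\|\partial_\nu\varphi\|^2_{L^2(\partial D)}\le C_T\,\|\Delta\varphi\|^2_{L^2(D)}$ for all $\varphi\in X(D)$. -/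

import Mathlib

open MeasureTheory Filter Topology
open scoped ContDiff ComplexConjugate

namespace ConductiveTE

noncomputable section

/-- The ambient space `ℝ^d` with the Euclidean norm. -/
abbrev E (d : ℕ) : Type := EuclideanSpace ℝ (Fin d)

/-! ### Domains -/

/-- The boundary of `D` is of class `C²`, with `D` lying locally on one side of it. -/
def HasC2Boundary {d : ℕ} (D : Set (E d)) : Prop :=
  ∀ x ∈ frontier D, ∃ (U : Set (E d)) (ρ : E d → ℝ), IsOpen U ∧ x ∈ U ∧ ContDiffOn ℝ 2 ρ U ∧
    (∀ y ∈ U, fderiv ℝ ρ y ≠ 0) ∧ D ∩ U = {y ∈ U | ρ y < 0}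

/-- Polygonal (for `d = 3`, polyhedral) domain without reentrant corners: the interior of a
convex polytope. -/
def IsConvexPolygonal {d : ℕ} (D : Set (E d)) : Prop :=
  ∃ s : Finset (E d), D = interior (convexHull ℝ (s : Set (E d)))

/-- Bounded simply connected open set whose boundary is either of class `C²` or polygonal with no
reentrant corners.  (Mathlib's simply connected sets are non-empty and path connected.) -/
structure IsAdmissibleDomain {d : ℕ} (D : Set (E d)) : Prop where
  isOpen : IsOpen D
  isBounded : Bornology.IsBounded D
  isSimplyConnected : IsSimplyConnected D
  boundary : HasC2Boundary D ∨ IsConvexPolygonal D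

/-- Surface measure on `∂D`: the normalised `(d-1)`-dimensional Hausdorff measure (arc length for
`d = 2`, surface area for `d = 3`) restricted to `∂D`. -/
def surfaceMeasure {d : ℕ} (D : Set (E d)) : Measure (E d) :=
  (Measure.euclideanHausdorffMeasure (d - 1)).restrict (frontier D)

/-- `ν` is the outward unit normal of `D` at `x`: near `x`, up to a cone of arbitrarily small
opening around the tangent hyperplane `x + ν^⊥`, the set `D` is the half-space on the side of
`-ν`. -/
def IsOuterUnitNormal {d : ℕ} (D : Set (E d)) (x ν : E d) : Prop :=
  ‖ν‖ = 1 ∧ ∀ ε : ℝ, 0 < ε → ∀ᶠ y in 𝓝 x,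
    (inner ℝ (y - x) ν < -(ε * ‖y - x‖) → y ∈ D) ∧ (ε * ‖y - x‖ < inner ℝ (y - x) ν → y ∉ D)

/-! ### Sobolev spaces -/

/-- Classical partial derivative `∂_i φ`. -/
def partialDeriv {d : ℕ} (i : Fin d) (φ : E d → ℂ) (x : E d) : ℂ :=
  fderiv ℝ φ x (EuclideanSpace.single i 1)

/-- `φ ∈ C_c^∞(D)`. -/
structure IsTestFunction {d : ℕ} (D : Set (E d)) (φ : E d → ℂ) : Prop where
  smooth : ContDiff ℝ ∞ φ
  compact : HasCompactSupport φ
  support : tsupport φ ⊆ D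

/-- `φ ∈ L²(D)`. -/
def MemL2 {d : ℕ} (D : Set (E d)) (f : E d → ℂ) : Prop := MemLp f 2 (volume.restrict D)

/-- `g ∈ L²(D)` is the weak partial derivative `∂_i f` in `D`. -/
def HasWeakPartial {d : ℕ} (D : Set (E d)) (i : Fin d) (f g : E d → ℂ) : Prop :=
  MemL2 D g ∧ ∀ φ, IsTestFunction D φ →
    ∫ x in D, f x * partialDeriv i φ x = - ∫ x in D, g x * φ x

open Classical in
/-- The weak partial derivative `∂_i f ∈ L²(D)` (unique up to null sets); `0` if there is none. -/
def weakPartial {d : ℕ} (D : Set (E d)) (i : Fin d) (f : E d → ℂ) : E d → ℂ :=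
  if h : ∃ g, HasWeakPartial D i f g then h.choose else 0

/-- `f ∈ H¹(D)`. -/
def MemH1 {d : ℕ} (D : Set (E d)) (f : E d → ℂ) : Prop :=
  MemL2 D f ∧ ∀ i, ∃ g, HasWeakPartial D i f g

/-- `f ∈ H²(D)`. -/
def MemH2 {d : ℕ} (D : Set (E d)) (f : E d → ℂ) : Prop :=
  MemH1 D f ∧ ∀ i, MemH1 D (weakPartial D i f)

/-- The smooth functions `F j` converge to `f ∈ H¹(D)` in the norm of `H¹(D)`. -/
def TendstoH1 {d : ℕ} (D : Set (E d)) (F : ℕ → E d → ℂ) (f : E d → ℂ) : Prop :=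
  Tendsto (fun j => eLpNorm (F j - f) 2 (volume.restrict D)) atTop (𝓝 0) ∧
    ∀ i, Tendsto (fun j => eLpNorm (partialDeriv i (F j) - weakPartial D i f) 2
      (volume.restrict D)) atTop (𝓝 0)

/-- `f ∈ H¹₀(D)`, the closure of `C_c^∞(D)` in `H¹(D)`. -/
def MemH10 {d : ℕ} (D : Set (E d)) (f : E d → ℂ) : Prop :=
  MemH1 D f ∧ ∃ F : ℕ → E d → ℂ, (∀ j, IsTestFunction D (F j)) ∧ TendstoH1 D F f

/-- `f ∈ X(D) = H²(D) ∩ H¹₀(D)`. -/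
def MemX {d : ℕ} (D : Set (E d)) (f : E d → ℂ) : Prop := MemH2 D f ∧ MemH10 D f

/-- `Δ f = ∑ ∂_i ∂_i f` for `f ∈ H²(D)`. -/
def laplacian {d : ℕ} (D : Set (E d)) (f : E d → ℂ) (x : E d) : ℂ :=
  ∑ i, weakPartial D i (weakPartial D i f) x

/-- `‖∇ f‖²_{L²(D)}`. -/
def gradNormSq {d : ℕ} (D : Set (E d)) (f : E d → ℂ) : ℝ :=
  ∫ x in D, ∑ i, ‖weakPartial D i f x‖ ^ 2

/-- `‖Δ f‖²_{L²(D)}`. -/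
def laplacianNormSq {d : ℕ} (D : Set (E d)) (f : E d → ℂ) : ℝ :=
  ∫ x in D, ‖laplacian D f x‖ ^ 2

/-- `f` does not vanish as an element of `L²(D)`. -/
def IsNontrivial {d : ℕ} (D : Set (E d)) (f : E d → ℂ) : Prop :=
  ¬ f =ᵐ[volume.restrict D] 0

/-! ### Traces -/

/-- `h ∈ L²(∂D)` is the trace of `f ∈ H¹(D)`: the trace operator is the continuous extension to
`H¹(D)` of the restriction to `∂D` of functions smooth up to the boundary. -/
def IsTrace {d : ℕ} (D : Set (E d)) (f h : E d → ℂ) : Prop :=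
  MemLp h 2 (surfaceMeasure D) ∧ ∃ F : ℕ → E d → ℂ, (∀ j, ContDiff ℝ ∞ (F j)) ∧
    TendstoH1 D F f ∧ Tendsto (fun j => eLpNorm (F j - h) 2 (surfaceMeasure D)) atTop (𝓝 0)

/-- `p ∈ L²(∂D)` is the normal derivative `∂_ν f = ν · ∇f` on `∂D` of `f ∈ H²(D)`, where `∇f` on
`∂D` is taken in the sense of traces and `ν` is the outward unit normal, which has to exist at
almost every boundary point. -/
def IsNormalDeriv {d : ℕ} (D : Set (E d)) (f p : E d → ℂ) : Prop :=
  MemLp p 2 (surfaceMeasure D) ∧ ∃ h : Fin d → E d → ℂ,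
    (∀ i, IsTrace D (weakPartial D i f) (h i)) ∧
    ∀ᵐ x ∂(surfaceMeasure D), ∃ ν, IsOuterUnitNormal D x ν ∧ p x = ∑ i, (ν i : ℂ) * h i x

/-- `C_T` is a constant in the trace inequality
`‖∂_ν φ‖²_{L²(∂D)} ≤ C_T ‖Δφ‖²_{L²(D)}` for all `φ ∈ X(D)`. -/
def IsTraceConstant {d : ℕ} (D : Set (E d)) (CT : ℝ) : Prop :=
  ∀ φ p, MemX D φ → IsNormalDeriv D φ p →
    ∫ x, ‖p x‖ ^ 2 ∂(surfaceMeasure D) ≤ CT * laplacianNormSq D φ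

/-- `Δ g = f` in `D` in the sense of distributions. -/
def HasDistribLaplacian {d : ℕ} (D : Set (E d)) (g f : E d → ℂ) : Prop :=
  ∀ φ, IsTestFunction D φ →
    ∫ x in D, g x * ∑ i, partialDeriv i (partialDeriv i φ) x = ∫ x in D, f x * φ x

/-- `h` is the trace on `∂D` of a function `g ∈ L²(D)` with `Δ g = f ∈ L²(D)`.  Such a `g` need not
be in `H¹(D)`; its trace is defined by duality through Green's second identity
`∫_D (g Δφ̄ - φ̄ Δg) = ∫_∂D g ∂_ν φ̄` for all `φ ∈ X(D)`. -/
def HasWeakTrace {d : ℕ} (D : Set (E d)) (g f h : E d → ℂ) : Prop :=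
  ∀ φ p, MemX D φ → IsNormalDeriv D φ p →
    ∫ x in D, (g x * conj (laplacian D φ x) - f x * conj (φ x)) =
      ∫ x, h x * conj (p x) ∂(surfaceMeasure D)

/-! ### The transmission eigenvalue problem -/

/-- The function `(n - 1)⁻¹ (Δu + k² n u)` on `D`. -/
def transmissionFlux {d : ℕ} (D : Set (E d)) (n : E d → ℝ) (k : ℂ) (u : E d → ℂ) (x : E d) : ℂ :=
  1 / ((n x : ℂ) - 1) * (laplacian D u x + k ^ 2 * n x * u x)

/-- `k` is a transmission eigenvalue with conductive boundary condition, for the refractive index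
`n` and the conductivity `η`: there is a nontrivial `u ∈ X(D)` such that
`(Δ + k²) (n - 1)⁻¹ (Δu + k² n u) = 0` in `D` and
`-(k² / η) ∂_ν u = (n - 1)⁻¹ (Δu + k² n u)` on `∂D`. -/
def IsTransmissionEigenvalue {d : ℕ} (D : Set (E d)) (n η : E d → ℝ) (k : ℂ) : Prop :=
  ∃ u p : E d → ℂ, MemX D u ∧ IsNontrivial D u ∧ IsNormalDeriv D u p ∧
    HasDistribLaplacian D (transmissionFlux D n k u)
      (fun x => -k ^ 2 * transmissionFlux D n k u x) ∧
    HasWeakTrace D (transmissionFlux D n k u) (fun x => -k ^ 2 * transmissionFlux D n k u x)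
      (fun x => -(k ^ 2 / η x) * p x)

/-! ### The simply supported plate buckling problem -/

/-- `ψ ∈ X(D)` is an eigenfunction with eigenvalue `lam > 0` of the simply supported plate buckling
problem `Δ²ψ = -lam Δψ` in `D`, `Δψ = 0` on `∂D` (the second boundary condition is the natural one
of the variational formulation in `X(D)`). -/
def IsBucklingEigenpair {d : ℕ} (D : Set (E d)) (lam : ℝ) (ψ : E d → ℂ) : Prop :=
  0 < lam ∧ MemX D ψ ∧ IsNontrivial D ψ ∧ ∀ φ, MemX D φ →
    ∫ x in D, laplacian D ψ x * conj (laplacian D φ x) =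
      lam * ∫ x in D, ∑ i, weakPartial D i ψ x * conj (weakPartial D i φ x)

/-- The first simply supported plate buckling eigenvalue
`λ₁ = min {‖Δφ‖² / ‖∇φ‖² : φ ∈ X(D), φ ≠ 0}`. -/
def firstBucklingEigenvalue {d : ℕ} (D : Set (E d)) : ℝ :=
  sInf {r : ℝ | ∃ φ, MemX D φ ∧ IsNontrivial D φ ∧ r = laplacianNormSq D φ / gradNormSq D φ}

/-! ### The first buckling eigenvalue is the smallest eigenvalue -/

lemma IsTestFunction.memLp {d : ℕ} {D : Set (E d)} {φ : E d → ℂ} (h : IsTestFunction D φ) :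
    MemLp φ 2 (volume.restrict D) :=
  (h.smooth.continuous.memLp_of_hasCompactSupport h.compact).restrict D

lemma IsTestFunction.memLp_partialDeriv {d : ℕ} {D : Set (E d)} {φ : E d → ℂ}
    (h : IsTestFunction D φ) (i : Fin d) : MemLp (partialDeriv i φ) 2 (volume.restrict D) := by
  have hc : Continuous (partialDeriv i φ) :=
    (h.smooth.continuous_fderiv (by simp)).clm_apply continuous_const
  exact (hc.memLp_of_hasCompactSupport (h.compact.fderiv_apply (𝕜 := ℝ) _)).restrict D

lemma HasWeakPartial.add_smul {d : ℕ} {D : Set (E d)} {i : Fin d} {f f' g g' : E d → ℂ}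
    (c : ℂ) (hf : MemL2 D f) (hf' : MemL2 D f') (h : HasWeakPartial D i f g)
    (h' : HasWeakPartial D i f' g') : HasWeakPartial D i (f + c • f') (g + c • g') := by
  refine ⟨MemLp.add h.1 (MemLp.const_smul h'.1 c), fun φ hφ => ?_⟩
  have i1 := MemLp.integrable_mul hf (hφ.memLp_partialDeriv i)
  have i2 := MemLp.integrable_mul hf' (hφ.memLp_partialDeriv i)
  have i3 := MemLp.integrable_mul h.1 hφ.memLp
  have i4 := MemLp.integrable_mul h'.1 hφ.memLp
  have e1 : ∫ x in D, (f + c • f') x * partialDeriv i φ x =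
      (∫ x in D, f x * partialDeriv i φ x) + c * ∫ x in D, f' x * partialDeriv i φ x := by
    rw [← integral_const_mul]
    refine Eq.trans ?_ (integral_add i1 (i2.const_mul c))
    congr 1; ext x; simp [add_mul, mul_assoc]
  have e2 : ∫ x in D, (g + c • g') x * φ x =
      (∫ x in D, g x * φ x) + c * ∫ x in D, g' x * φ x := by
    rw [← integral_const_mul]
    refine Eq.trans ?_ (integral_add i3 (i4.const_mul c))
    congr 1; ext x; simp [add_mul, mul_assoc]
  rw [e1, e2, h.2 φ hφ, h'.2 φ hφ]; ring

lemma HasWeakPartial.congr {d : ℕ} {D : Set (E d)} {i : Fin d} {f f' g : E d → ℂ}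
    (h : HasWeakPartial D i f g) (hff : f =ᵐ[volume.restrict D] f') :
    HasWeakPartial D i f' g := by
  refine ⟨h.1, fun φ hφ => ?_⟩
  rw [← h.2 φ hφ]
  apply integral_congr_ae
  filter_upwards [hff] with x hx
  rw [hx]

lemma HasWeakPartial.ae_eq {d : ℕ} {D : Set (E d)} (hD : IsOpen D) {i : Fin d}
    {f g g' : E d → ℂ} (h : HasWeakPartial D i f g) (h' : HasWeakPartial D i f g') :
    g =ᵐ[volume.restrict D] g' := by
  have hL : LocallyIntegrableOn (g - g') D volume :=
    locallyIntegrableOn_of_locallyIntegrable_restrict ((h.1.sub h'.1).locallyIntegrable (by simp))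
  have key := hD.ae_eq_zero_of_integral_contDiff_smul_eq_zero (f := g - g')
    (μ := volume.restrict D) (hL.mono_measure Measure.restrict_le_self) ?_
  · filter_upwards [key, ae_restrict_mem hD.measurableSet] with x hx hxD
    exact sub_eq_zero.1 (hx hxD)
  · intro φ h1 h2 h3
    have hφ : IsTestFunction D (fun x => (φ x : ℂ)) := by
      refine ⟨Complex.ofRealCLM.contDiff.comp h1, h2.comp_left (g := Complex.ofReal) rfl, ?_⟩
      exact (closure_mono (Function.support_comp_subset (g := Complex.ofReal) rfl φ)).trans h3
    have e := (h.2 _ hφ).symm.trans (h'.2 _ hφ)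
    have i1 := MemLp.integrable_mul h.1 hφ.memLp
    have i2 := MemLp.integrable_mul h'.1 hφ.memLp
    have e3 := integral_sub i1 i2
    simp only [Pi.mul_apply] at e3
    rw [neg_inj.1 e, sub_self] at e3
    rw [← e3]
    congr 1; ext x; simp; ring

lemma weakPartial_spec {d : ℕ} {D : Set (E d)} {i : Fin d} {f : E d → ℂ}
    (h : ∃ g, HasWeakPartial D i f g) : HasWeakPartial D i f (weakPartial D i f) := by
  unfold weakPartial
  rw [dif_pos h]
  exact h.choose_spec

lemma MemH1.add_smul {d : ℕ} {D : Set (E d)} {f f' : E d → ℂ} (c : ℂ)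
    (h : MemH1 D f) (h' : MemH1 D f') : MemH1 D (f + c • f') :=
  ⟨MemLp.add h.1 (MemLp.const_smul h'.1 c), fun i =>
    ⟨_, (weakPartial_spec (h.2 i)).add_smul c h.1 h'.1 (weakPartial_spec (h'.2 i))⟩⟩

lemma MemH1.congr {d : ℕ} {D : Set (E d)} {f f' : E d → ℂ} (h : MemH1 D f)
    (hff : f =ᵐ[volume.restrict D] f') : MemH1 D f' :=
  ⟨(memLp_congr_ae hff).1 h.1, fun i => ⟨_, (weakPartial_spec (h.2 i)).congr hff⟩⟩

lemma weakPartial_add_smul {d : ℕ} {D : Set (E d)} (hD : IsOpen D) {f f' : E d → ℂ} (c : ℂ)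
    (h : MemH1 D f) (h' : MemH1 D f') (i : Fin d) :
    weakPartial D i (f + c • f') =ᵐ[volume.restrict D]
      weakPartial D i f + c • weakPartial D i f' :=
  (weakPartial_spec ((h.add_smul c h').2 i)).ae_eq hD
    ((weakPartial_spec (h.2 i)).add_smul c h.1 h'.1 (weakPartial_spec (h'.2 i)))

lemma weakPartial_congr {d : ℕ} {D : Set (E d)} (hD : IsOpen D) {f f' : E d → ℂ}
    (h : MemH1 D f) (hff : f =ᵐ[volume.restrict D] f') (i : Fin d) :
    weakPartial D i f =ᵐ[volume.restrict D] weakPartial D i f' :=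
  ((weakPartial_spec (h.2 i)).congr hff).ae_eq hD (weakPartial_spec ((h.congr hff).2 i))

lemma MemX.add_smul {d : ℕ} {D : Set (E d)} (hD : IsOpen D) {f f' : E d → ℂ} (c : ℂ)
    (h : MemX D f) (h' : MemX D f') : MemX D (f + c • f') := by
  have h1 := h.1.1.add_smul c h'.1.1
  refine ⟨⟨h1, fun i => ((h.1.2 i).add_smul c (h'.1.2 i)).congr
    (weakPartial_add_smul hD c h.1.1 h'.1.1 i).symm⟩, h1, ?_⟩
  obtain ⟨-, F, hF, hF1, hF2⟩ := h.2
  obtain ⟨-, F', hF', hF1', hF2'⟩ := h'.2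
  have lim : ∀ {A A' : ℕ → E d → ℂ} {a a' : E d → ℂ}, (∀ j, MemL2 D (A j)) →
      (∀ j, MemL2 D (A' j)) → MemL2 D a → MemL2 D a' →
      Tendsto (fun j => eLpNorm (A j - a) 2 (volume.restrict D)) atTop (𝓝 0) →
      Tendsto (fun j => eLpNorm (A' j - a') 2 (volume.restrict D)) atTop (𝓝 0) →
      Tendsto (fun j => eLpNorm (A j + c • A' j - (a + c • a')) 2 (volume.restrict D))
        atTop (𝓝 0) := by
    intro A A' a a' hA hA' ha ha' t t'
    have t2 : Tendsto (fun j => eLpNorm (A j - a) 2 (volume.restrict D) +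
        ‖c‖ₑ * eLpNorm (A' j - a') 2 (volume.restrict D)) atTop (𝓝 0) := by
      have := t.add (ENNReal.Tendsto.const_mul t' (Or.inr (enorm_ne_top (x := c))))
      simpa using this
    refine tendsto_of_tendsto_of_tendsto_of_le_of_le tendsto_const_nhds t2 (fun _ => zero_le)
      fun j => ?_
    have e : A j + c • A' j - (a + c • a') = (A j - a) + c • (A' j - a') := by
      rw [smul_sub]; abel
    simp only [e]
    refine (eLpNorm_add_le ((hA j).sub ha).1 (((hA' j).sub ha').const_smul c).1
      (by norm_num)).trans ?_
    rw [eLpNorm_const_smul]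
  refine ⟨fun j => F j + c • F' j, fun j => ⟨?_, ?_, ?_⟩, ?_, fun i => ?_⟩
  · exact (hF j).smooth.add ((hF' j).smooth.const_smul c)
  · exact (hF j).compact.add ((hF' j).compact.smul_left (f := fun _ => c))
  · refine (tsupport_add _ _).trans (Set.union_subset (hF j).support ?_)
    exact (closure_mono (Function.support_const_smul_subset c (F' j))).trans (hF' j).support
  · exact lim (fun j => (hF j).memLp) (fun j => (hF' j).memLp) h.1.1.1 h'.1.1.1 hF1 hF1'
  · have e : ∀ j, partialDeriv i (F j + c • F' j) =
        partialDeriv i (F j) + c • partialDeriv i (F' j) := by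
      intro j
      ext x
      have d1 := ((hF j).smooth.differentiable (by simp)) x
      have d2 := ((hF' j).smooth.differentiable (by simp)) x
      simp [partialDeriv, fderiv_add d1 (d2.const_smul c), fderiv_const_smul d2]
    have l := lim (fun j => (hF j).memLp_partialDeriv i) (fun j => (hF' j).memLp_partialDeriv i)
      (weakPartial_spec (h.1.1.2 i)).1 (weakPartial_spec (h'.1.1.2 i)).1 (hF2 i) (hF2' i)
    refine l.congr fun j => ?_
    rw [e j]
    exact eLpNorm_congr_ae ((ae_eq_refl _).sub (weakPartial_add_smul hD c h.1.1 h'.1.1 i).symm)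

lemma laplacian_add_smul {d : ℕ} {D : Set (E d)} (hD : IsOpen D) {f f' : E d → ℂ} (c : ℂ)
    (h : MemX D f) (h' : MemX D f') :
    laplacian D (f + c • f') =ᵐ[volume.restrict D] laplacian D f + c • laplacian D f' := by
  have key : ∀ i, weakPartial D i (weakPartial D i (f + c • f')) =ᵐ[volume.restrict D]
      weakPartial D i (weakPartial D i f) + c • weakPartial D i (weakPartial D i f') := fun i =>
    (weakPartial_congr hD ((h.add_smul hD c h').1.2 i)
      (weakPartial_add_smul hD c h.1.1 h'.1.1 i) i).trans
      (weakPartial_add_smul hD c (h.1.2 i) (h'.1.2 i) i)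
  filter_upwards [ae_all_iff.2 key] with x hx
  simp only [laplacian, hx, Pi.add_apply, Pi.smul_apply, smul_eq_mul, Finset.sum_add_distrib,
    Finset.mul_sum]

lemma MemX.memLp_weakPartial {d : ℕ} {D : Set (E d)} {f : E d → ℂ} (h : MemX D f) (i : Fin d) :
    MemL2 D (weakPartial D i f) := (weakPartial_spec (h.1.1.2 i)).1

lemma MemX.memLp_laplacian {d : ℕ} {D : Set (E d)} {f : E d → ℂ} (h : MemX D f) :
    MemL2 D (laplacian D f) :=
  memLp_finsetSum _ fun i _ => (weakPartial_spec ((h.1.2 i).2 i)).1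

lemma integral_mul_conj_self {d : ℕ} {D : Set (E d)} (f : E d → ℂ) :
    ∫ x in D, f x * conj (f x) = ((∫ x in D, ‖f x‖ ^ 2 : ℝ) : ℂ) := by
  rw [← integral_complex_ofReal]
  congr 1; ext x; rw [Complex.mul_conj']; push_cast; rfl

/-- Every eigenvalue of the buckling problem is a Rayleigh quotient. -/
lemma IsBucklingEigenpair.laplacianNormSq_eq {d : ℕ} {D : Set (E d)} {lam : ℝ} {ψ : E d → ℂ}
    (h : IsBucklingEigenpair D lam ψ) : laplacianNormSq D ψ = lam * gradNormSq D ψ := by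
  obtain ⟨-, hX, -, hw⟩ := h
  have := hw ψ hX
  rw [integral_mul_conj_self] at this
  have e : ∫ x in D, ∑ i, weakPartial D i ψ x * conj (weakPartial D i ψ x) =
      (gradNormSq D ψ : ℂ) := by
    rw [gradNormSq, ← integral_complex_ofReal]
    congr 1; ext x; push_cast
    exact Finset.sum_congr rfl fun i _ => Complex.mul_conj' _
  rw [e] at this
  exact_mod_cast this

lemma bddBelow_rayleigh {d : ℕ} (D : Set (E d)) : BddBelow {r : ℝ | ∃ φ, MemX D φ ∧
    IsNontrivial D φ ∧ r = laplacianNormSq D φ / gradNormSq D φ} := by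
  refine ⟨0, ?_⟩
  rintro r ⟨φ, -, -, rfl⟩
  exact div_nonneg (integral_nonneg fun x => by positivity)
    (integral_nonneg fun x => by positivity)

/-- No eigenvalue of the buckling problem is smaller than `firstBucklingEigenvalue D`. -/
lemma firstBucklingEigenvalue_le {d : ℕ} {D : Set (E d)} {lam : ℝ} {ψ : E d → ℂ}
    (h : IsBucklingEigenpair D lam ψ) : firstBucklingEigenvalue D ≤ lam := by
  have h1 := csInf_le (bddBelow_rayleigh D) ⟨ψ, h.2.1, h.2.2.1, rfl⟩
  refine h1.trans ?_
  rw [h.laplacianNormSq_eq]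
  rcases eq_or_ne (gradNormSq D ψ) 0 with h0 | h0
  · rw [h0]; simpa using h.1.le
  · rw [mul_div_cancel_right₀ _ h0]

lemma integral_normSq_add_smul {d : ℕ} {D : Set (E d)} {a b : E d → ℂ} (ha : MemL2 D a)
    (hb : MemL2 D b) (c : ℂ) : ∫ x in D, ‖(a + c • b) x‖ ^ 2 =
      (∫ x in D, ‖a x‖ ^ 2) + 2 * (conj c * ∫ x in D, a x * conj (b x)).re +
        ‖c‖ ^ 2 * ∫ x in D, ‖b x‖ ^ 2 := by
  have ia := ha.integrable_norm_pow (by norm_num : (2 : ℕ) ≠ 0)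
  have ib := hb.integrable_norm_pow (by norm_num : (2 : ℕ) ≠ 0)
  have iab : Integrable (fun x => a x * conj (b x)) (volume.restrict D) :=
    MemLp.integrable_mul ha hb.star
  have e1 : (conj c * ∫ x in D, a x * conj (b x)).re =
      ∫ x in D, (conj c * (a x * conj (b x))).re := by
    rw [← integral_const_mul]
    exact (integral_re (iab.const_mul _)).symm
  have ic : Integrable (fun x => (conj c * (a x * conj (b x))).re) (volume.restrict D) :=
    (iab.const_mul (conj c)).re
  rw [e1, ← integral_const_mul, ← integral_const_mul]
  rw [← integral_add ia (ic.const_mul 2)]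
  refine Eq.trans ?_ (integral_add (ia.add (ic.const_mul 2)) (ib.const_mul (‖c‖ ^ 2)))
  congr 1
  ext x
  simp only [Pi.add_apply, Pi.smul_apply, smul_eq_mul, ← Complex.normSq_eq_norm_sq,
    Complex.normSq_apply, Complex.add_re, Complex.add_im, Complex.mul_re, Complex.mul_im,
    Complex.conj_re, Complex.conj_im]
  ring

lemma gradNormSq_eq_sum {d : ℕ} {D : Set (E d)} {f : E d → ℂ} (h : MemX D f) :
    gradNormSq D f = ∑ i, ∫ x in D, ‖weakPartial D i f x‖ ^ 2 :=
  integral_finsetSum _ fun i _ =>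
    (h.memLp_weakPartial i).integrable_norm_pow (by norm_num : (2 : ℕ) ≠ 0)

lemma firstBucklingEigenvalue_mul_le {d : ℕ} {D : Set (E d)} (hD : IsOpen D) {f : E d → ℂ}
    (h : MemX D f) : firstBucklingEigenvalue D * gradNormSq D f ≤ laplacianNormSq D f := by
  have hl : 0 ≤ laplacianNormSq D f := integral_nonneg fun x => by positivity
  have hg : 0 ≤ gradNormSq D f := integral_nonneg fun x => by positivity
  rcases eq_or_lt_of_le hg with h0 | h0
  · rw [← h0]; simpa using hl
  · refine (le_div_iff₀ h0).1 (csInf_le (bddBelow_rayleigh D) ⟨f, h, fun hf => ?_, rfl⟩)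
    have z : ∀ i, weakPartial D i f =ᵐ[volume.restrict D] 0 := fun i =>
      HasWeakPartial.ae_eq hD (weakPartial_spec (h.1.1.2 i))
        (HasWeakPartial.congr (f := 0) ⟨MemLp.zero, fun φ _ => by simp⟩ hf.symm)
    have : gradNormSq D f = 0 := by
      rw [gradNormSq]
      refine integral_eq_zero_of_ae ?_
      filter_upwards [ae_all_iff.2 z] with x hx
      simp [hx]
    exact h0.ne' this

/-- If the infimum of the Rayleigh quotient is attained (and positive), each minimiser is an
eigenfunction of the buckling problem, and `firstBucklingEigenvalue D` is the smallest eigenvalue. -/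
lemma isLeast_firstBucklingEigenvalue {d : ℕ} {D : Set (E d)} (hD : IsOpen D) {ψ : E d → ℂ}
    (hpos : 0 < firstBucklingEigenvalue D) (hψ : MemX D ψ) (hne : IsNontrivial D ψ)
    (hatt : laplacianNormSq D ψ = firstBucklingEigenvalue D * gradNormSq D ψ) :
    IsBucklingEigenpair D (firstBucklingEigenvalue D) ψ ∧
      IsLeast {lam | ∃ φ, IsBucklingEigenpair D lam φ} (firstBucklingEigenvalue D) := by
  suffices hE : IsBucklingEigenpair D (firstBucklingEigenvalue D) ψ from
    ⟨hE, ⟨ψ, hE⟩, fun lam ⟨φ, hφ⟩ => firstBucklingEigenvalue_le hφ⟩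
  refine ⟨hpos, hψ, hne, fun φ hφ => ?_⟩
  set L := firstBucklingEigenvalue D with hL
  set B1 := ∫ x in D, laplacian D ψ x * conj (laplacian D φ x) with hB1
  have iB : ∀ i, Integrable (fun x => weakPartial D i ψ x * conj (weakPartial D i φ x))
      (volume.restrict D) := fun i =>
    MemLp.integrable_mul (hψ.memLp_weakPartial i) (hφ.memLp_weakPartial i).star
  rw [integral_finsetSum _ fun i _ => iB i]
  set B2 := ∑ i, ∫ x in D, weakPartial D i ψ x * conj (weakPartial D i φ x) with hB2
  have hlap : ∀ c : ℂ, laplacianNormSq D (ψ + c • φ) =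
      laplacianNormSq D ψ + 2 * (conj c * B1).re + ‖c‖ ^ 2 * laplacianNormSq D φ := by
    intro c
    refine Eq.trans ?_ (integral_normSq_add_smul hψ.memLp_laplacian hφ.memLp_laplacian c)
    refine integral_congr_ae ?_
    filter_upwards [laplacian_add_smul hD c hψ hφ] with x hx
    rw [hx]
  have hgrad : ∀ c : ℂ, gradNormSq D (ψ + c • φ) =
      gradNormSq D ψ + 2 * (conj c * B2).re + ‖c‖ ^ 2 * gradNormSq D φ := by
    intro c
    rw [gradNormSq_eq_sum (hψ.add_smul hD c hφ), gradNormSq_eq_sum hψ, gradNormSq_eq_sum hφ, hB2,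
      Finset.mul_sum, Complex.re_sum, Finset.mul_sum, Finset.mul_sum, ← Finset.sum_add_distrib,
      ← Finset.sum_add_distrib]
    refine Finset.sum_congr rfl fun i _ => ?_
    refine Eq.trans ?_ (integral_normSq_add_smul (hψ.memLp_weakPartial i)
      (hφ.memLp_weakPartial i) c)
    refine integral_congr_ae ?_
    filter_upwards [weakPartial_add_smul hD c hψ.1.1 hφ.1.1 i] with x hx
    rw [hx]
  set Q := laplacianNormSq D φ - L * gradNormSq D φ with hQ
  have hQ0 : 0 ≤ Q := sub_nonneg.2 (firstBucklingEigenvalue_mul_le hD hφ)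
  have hmain : ∀ c : ℂ, 0 ≤ 2 * (conj c * (B1 - L * B2)).re + ‖c‖ ^ 2 * Q := by
    intro c
    have h1 := firstBucklingEigenvalue_mul_le hD (hψ.add_smul hD c hφ)
    rw [hlap, hgrad, ← hL, hatt] at h1
    have e : (conj c * (B1 - L * B2)).re = (conj c * B1).re - L * (conj c * B2).re := by
      rw [mul_sub, Complex.sub_re, mul_left_comm, Complex.re_ofReal_mul]
    rw [e, hQ]
    linarith
  by_contra hne'
  have hB : 0 < ‖B1 - L * B2‖ ^ 2 := by
    have := norm_pos_iff.2 (sub_ne_zero.2 hne')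
    positivity
  have h2 := hmain (-((1 / (Q + 1) : ℝ) : ℂ) * (B1 - L * B2))
  have e2 : (conj (-((1 / (Q + 1) : ℝ) : ℂ) * (B1 - L * B2)) * (B1 - L * B2)).re =
      -(1 / (Q + 1)) * ‖B1 - L * B2‖ ^ 2 := by
    rw [map_mul, mul_assoc, mul_comm (conj (B1 - L * B2)), Complex.mul_conj', map_neg,
      Complex.conj_ofReal]
    norm_cast
  have e3 : ‖-((1 / (Q + 1) : ℝ) : ℂ) * (B1 - L * B2)‖ ^ 2 =
      (1 / (Q + 1)) ^ 2 * ‖B1 - L * B2‖ ^ 2 := by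
    rw [norm_mul, norm_neg, Complex.norm_real, mul_pow, Real.norm_eq_abs, sq_abs]
  rw [e2, e3] at h2
  have h3 : 2 * (-(1 / (Q + 1)) * ‖B1 - L * B2‖ ^ 2) +
      (1 / (Q + 1)) ^ 2 * ‖B1 - L * B2‖ ^ 2 * Q =
      -((Q + 2) / (Q + 1) ^ 2 * ‖B1 - L * B2‖ ^ 2) := by
    field_simp
    ring
  rw [h3] at h2
  have : 0 < (Q + 2) / (Q + 1) ^ 2 * ‖B1 - L * B2‖ ^ 2 := by positivity
  linarith

end

end ConductiveTE

open ConductiveTE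

/-! Write `κ = k²` and `g = (Δu + κnu)/(n - 1)`. Testing the duality identity for the trace of `g`
with `u` itself gives `∫_D g conj(Δu + κu) = -κ ∫_∂D |∂_ν u|²/η` (`integral_re_flux_eq`). Completing
the square pointwise bounds the real part of the integrand from below by `|Δu|²/n + κ Re(Δu ū)` if
`n > 1`, and its negative by `|Δu|² + κ Re(Δu ū)` if `0 ≤ n < 1`. Since `∫_D Δu ū = -‖∇u‖²`,
integration yields `‖Δu‖²/nmax ≤ κ‖∇u‖²` if `n > 1` (the boundary term has the good sign), and
`‖Δu‖² ≤ κ‖∇u‖² + κ(C_T/ηmin)‖Δu‖²` if `0 ≤ n < 1`.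

In both cases the conclusion is the Rayleigh bound `λ₁‖∇u‖² ≤ ‖Δu‖²` followed by cancelling a
positive norm. That `‖∇u‖ > 0` for nontrivial `u` comes from a Poincaré inequality on the bounded
set `D` (`MemX.gradNormSq_pos`). -/

namespace ConductiveTE

/-! ### Integration by parts in `H¹₀(D)` and Green's first identity. -/

/-- Pairing with a fixed `L²` function is continuous along `L²` convergence. -/
lemma tendsto_integral_mul_conj {d : ℕ} {D : Set (E d)} {a f : E d → ℂ} {F : ℕ → E d → ℂ}
    (ha : MemL2 D a) (hF : ∀ j, MemL2 D (F j)) (hf : MemL2 D f)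
    (h : Tendsto (fun j => eLpNorm (F j - f) 2 (volume.restrict D)) atTop (𝓝 0)) :
    Tendsto (fun j => ∫ x in D, a x * conj (F j x)) atTop (𝓝 (∫ x in D, a x * conj (f x))) := by
  have hm : AEStronglyMeasurable (fun x => a x * conj (f x)) (volume.restrict D) :=
    (MemLp.integrable_mul ha hf.star).aestronglyMeasurable
  refine tendsto_integral_of_L1' _ hm
    (Eventually.of_forall fun j => MemLp.integrable_mul ha (hF j).star) ?_
  -- By Hölder with exponents `2, 2, 1`, this product dominates the `L¹` distance between the
  -- integrands.
  have hz : Tendsto (fun j => eLpNorm a 2 (volume.restrict D) *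
      eLpNorm (F j - f) 2 (volume.restrict D)) atTop (𝓝 0) := by
    simpa using ENNReal.Tendsto.const_mul h (Or.inr ha.2.ne)
  refine tendsto_of_tendsto_of_tendsto_of_le_of_le tendsto_const_nhds hz (fun _ => zero_le)
    fun j => ?_
  have e : (fun x => a x * conj (F j x)) - (fun x => a x * conj (f x)) =
      a • star (F j - f) := by
    ext x; simp [mul_sub]
  have := eLpNorm_smul_le_mul_eLpNorm (p := 2) (q := 2) (r := 1) ((hF j).sub hf).star.1 ha.1
  rw [e]
  refine this.trans_eq ?_
  congr 1
  exact eLpNorm_congr_norm_ae (Eventually.of_forall fun x => norm_star _)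

lemma partialDeriv_conj {d : ℕ} {φ : E d → ℂ} (h : ContDiff ℝ ∞ φ) (i : Fin d) (x : E d) :
    partialDeriv i (fun y => conj (φ y)) x = conj (partialDeriv i φ x) := by
  have hd : DifferentiableAt ℝ φ x := (h.differentiable (by simp)).differentiableAt
  have := (Complex.conjCLE.toContinuousLinearMap.hasFDerivAt.comp x hd.hasFDerivAt).fderiv
  unfold partialDeriv
  change fderiv ℝ (Complex.conjCLE.toContinuousLinearMap ∘ φ) x _ = _
  rw [this]
  rfl

lemma IsTestFunction.conj {d : ℕ} {D : Set (E d)} {φ : E d → ℂ} (h : IsTestFunction D φ) :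
    IsTestFunction D (fun x => conj (φ x)) where
  smooth := Complex.conjCLE.toContinuousLinearMap.contDiff.comp h.smooth
  compact := h.compact.comp_left (g := fun z : ℂ => (starRingEnd ℂ) z) (by simp)
  support := (closure_mono (Function.support_comp_subset
    (g := fun z : ℂ => (starRingEnd ℂ) z) (by simp) φ)).trans h.support

/-- Integration by parts `∫_D (∂_i g) f̄ = -∫_D g ∂_i f̄` for `f ∈ H¹₀(D)`. -/
lemma HasWeakPartial.integral_mul_conj {d : ℕ} {D : Set (E d)} {i : Fin d} {f g g' : E d → ℂ}
    (hf : MemH10 D f) (hg : MemL2 D g) (h : HasWeakPartial D i g g') :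
    ∫ x in D, g' x * conj (f x) = -∫ x in D, g x * conj (weakPartial D i f x) := by
  obtain ⟨hf1, F, hF, t0, t1⟩ := hf
  have l1 := tendsto_integral_mul_conj h.1 (fun j => (hF j).memLp) hf1.1 t0
  have l2 := (tendsto_integral_mul_conj hg (fun j => (hF j).memLp_partialDeriv i)
    (weakPartial_spec (hf1.2 i)).1 (t1 i)).neg
  refine tendsto_nhds_unique l1 (l2.congr fun j => ?_)
  -- For each `j` the identity is the definition of the weak derivative, tested with the conjugate
  -- of `F j`; both sides pass to the limit.
  have := h.2 _ (hF j).conj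
  simp only [partialDeriv_conj (hF j).smooth] at this
  rw [this, neg_neg]

/-- Green's first identity `∫_D Δu ū = -‖∇u‖²` in `X(D)`. -/
lemma MemX.integral_laplacian_mul_conj {d : ℕ} {D : Set (E d)} {u : E d → ℂ} (h : MemX D u) :
    ∫ x in D, laplacian D u x * conj (u x) = -(gradNormSq D u : ℂ) := by
  have hw := fun i => weakPartial_spec ((h.1.2 i).2 i)
  simp only [laplacian, Finset.sum_mul]
  have hi : ∀ i, Integrable (fun x => weakPartial D i (weakPartial D i u) x * conj (u x))
      (volume.restrict D) := fun i => MemLp.integrable_mul (hw i).1 h.1.1.1.star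
  rw [integral_finsetSum _ fun i _ => hi i, gradNormSq_eq_sum h]
  push_cast
  rw [← Finset.sum_neg_distrib]
  refine Finset.sum_congr rfl fun i _ => ?_
  rw [(hw i).integral_mul_conj h.2 (h.memLp_weakPartial i), integral_mul_conj_self]

/-! ### Poincaré inequality and positivity of the gradient norm. -/

/-- Expand a vector in the standard basis and use `|v i| ≤ ‖v‖`. The redundant outer norm on the
right is the shape that `eLpNorm_mono` requires. -/
lemma norm_fderiv_le_sum_partialDeriv {d : ℕ} (φ : E d → ℂ) (x : E d) :
    ‖fderiv ℝ φ x‖ ≤ ‖∑ i, ‖partialDeriv i φ x‖‖ := by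
  refine (ContinuousLinearMap.opNorm_le_bound _ ?_ fun v => ?_).trans (le_abs_self _)
  · positivity
  · have hv : v = ∑ i, v i • EuclideanSpace.single i (1 : ℝ) := by
      ext j
      simp [Finset.sum_apply, Pi.single_apply]
    conv_lhs => rw [hv]
    rw [map_sum, Finset.sum_mul]
    refine norm_sum_le_of_le _ fun i _ => ?_
    rw [map_smul, norm_smul, mul_comm]
    exact mul_le_mul_of_nonneg_left (PiLp.norm_apply_le v i) (norm_nonneg _)

/-- A Poincaré inequality for test functions on bounded domains. -/
lemma exists_eLpNorm_le_sum_partialDeriv {d : ℕ} (hd : 2 ≤ d) {D : Set (E d)}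
    (hb : Bornology.IsBounded D) : ∃ C : ENNReal, C ≠ ⊤ ∧ ∀ φ, IsTestFunction D φ →
      eLpNorm φ 1 (volume.restrict D) ≤
        C * ∑ i, eLpNorm (partialDeriv i φ) 2 (volume.restrict D) := by
  have hvol : volume D ≠ ⊤ := hb.measure_lt_top.ne
  set K := eLpNormLESNormFDerivOfLeConst ℂ (volume : Measure (E d)) D 1 1
  set M := (volume.restrict D Set.univ) ^ (1 / (1 : ENNReal).toReal - 1 / (2 : ENNReal).toReal)
  have hM : M ≠ ⊤ := ENNReal.rpow_ne_top_of_nonneg (by norm_num) (by simpa using hvol)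
  refine ⟨K * M, ENNReal.mul_ne_top ENNReal.coe_ne_top hM, fun φ hφ => ?_⟩
  have hfr : Module.finrank ℝ (E d) = d := by simp
  have h1 : eLpNorm φ 1 volume ≤ K * eLpNorm (fderiv ℝ φ) 1 volume := by
    -- Sobolev inequality with both exponents `1`. It needs the exponent to be below the dimension,
    -- hence `2 ≤ d`. An `L¹` bound is enough to show that a function vanishes.
    have := eLpNorm_le_eLpNorm_fderiv_of_le (volume : Measure (E d)) (u := φ) (s := D)
      (p := 1) (q := 1) (hφ.smooth.of_le (by simp)) ((subset_tsupport φ).trans hφ.support)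
      le_rfl (by rw [hfr]; exact_mod_cast hd) (by rw [hfr]; simp) hb
    simpa using this
  have hs : Function.support (fderiv ℝ φ) ⊆ D :=
    (support_fderiv_subset ℝ).trans hφ.support
  have hm : ∀ i, AEStronglyMeasurable (partialDeriv i φ) (volume.restrict D) :=
    fun i => (hφ.memLp_partialDeriv i).1
  calc eLpNorm φ 1 (volume.restrict D)
      ≤ eLpNorm φ 1 volume := eLpNorm_mono_measure _ Measure.restrict_le_self
    _ ≤ K * eLpNorm (fderiv ℝ φ) 1 volume := h1
    _ = K * eLpNorm (fderiv ℝ φ) 1 (volume.restrict D) := by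
      rw [eLpNorm_restrict_eq_of_support_subset (f := fderiv ℝ φ) hs]
    _ ≤ K * eLpNorm (∑ i, fun x => ‖partialDeriv i φ x‖) 1 (volume.restrict D) := by
      gcongr
      refine eLpNorm_mono fun x => ?_
      simpa using norm_fderiv_le_sum_partialDeriv φ x
    _ ≤ K * ∑ i, eLpNorm (partialDeriv i φ) 1 (volume.restrict D) := by
      gcongr
      refine (eLpNorm_sum_le (fun i _ => (hm i).norm) le_rfl).trans_eq ?_
      exact Finset.sum_congr rfl fun i _ => eLpNorm_norm _
    -- Hölder on the finite-measure set `D`; the factor `M` is `|D|^(1/2)`.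
    _ ≤ K * ∑ i, eLpNorm (partialDeriv i φ) 2 (volume.restrict D) * M := by
      gcongr with i
      exact eLpNorm_le_eLpNorm_mul_rpow_measure_univ (by norm_num) (hm i)
    _ = K * M * ∑ i, eLpNorm (partialDeriv i φ) 2 (volume.restrict D) := by
      rw [← Finset.sum_mul, mul_assoc, mul_comm M]

/-- A function in `H¹₀(D)` with vanishing gradient vanishes. -/
lemma MemH10.ae_eq_zero {d : ℕ} (hd : 2 ≤ d) {D : Set (E d)} (hb : Bornology.IsBounded D)
    {u : E d → ℂ} (h : MemH10 D u) (hz : ∀ i, weakPartial D i u =ᵐ[volume.restrict D] 0) :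
    u =ᵐ[volume.restrict D] 0 := by
  obtain ⟨C, hC, hP⟩ := exists_eLpNorm_le_sum_partialDeriv hd hb
  obtain ⟨h1, F, hF, t0, t1⟩ := h
  set μ := volume.restrict D with hμ
  have hfin : μ Set.univ ≠ ⊤ := by simpa [hμ] using hb.measure_lt_top.ne
  set M := (μ Set.univ) ^ (1 / (1 : ENNReal).toReal - 1 / (2 : ENNReal).toReal)
  have hM : M ≠ ⊤ := ENNReal.rpow_ne_top_of_nonneg (by norm_num) hfin
  -- As `∂_i u = 0`, the norm of `∂_i (F j)` is its distance to `∂_i u`, which tends to zero.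
  have hp : ∀ i j, eLpNorm (partialDeriv i (F j)) 2 μ =
      eLpNorm (partialDeriv i (F j) - weakPartial D i u) 2 μ := fun i j => by
    refine eLpNorm_congr_ae ?_
    filter_upwards [hz i] with x hx
    simp [hx]
  have hlim : Tendsto (fun j => C * ∑ i, eLpNorm (partialDeriv i (F j)) 2 μ +
      eLpNorm (F j - u) 2 μ * M) atTop (𝓝 0) := by
    have s : Tendsto (fun j => ∑ i, eLpNorm (partialDeriv i (F j)) 2 μ) atTop (𝓝 0) := by
      simp only [hp]
      simpa using tendsto_finsetSum Finset.univ fun i _ => t1 i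
    simpa using (ENNReal.Tendsto.const_mul s (Or.inr hC)).add
      (ENNReal.Tendsto.mul_const t0 (Or.inr hM))
  -- Split `u = F j - (F j - u)`: Poincaré controls the first term, Hölder the second.
  have hle : ∀ j, eLpNorm u 1 μ ≤ C * ∑ i, eLpNorm (partialDeriv i (F j)) 2 μ +
      eLpNorm (F j - u) 2 μ * M := fun j => by
    have hm := ((hF j).memLp.sub h1.1).1
    have e : u = F j - (F j - u) := by abel
    calc eLpNorm u 1 μ = eLpNorm (F j - (F j - u)) 1 μ := by rw [← e]
      _ ≤ eLpNorm (F j) 1 μ + eLpNorm (F j - u) 1 μ :=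
        eLpNorm_sub_le (hF j).memLp.1 hm le_rfl
      _ ≤ _ := add_le_add (hP _ (hF j))
        (eLpNorm_le_eLpNorm_mul_rpow_measure_univ (by norm_num) hm)
  have h0 : eLpNorm u 1 μ = 0 := le_antisymm (ge_of_tendsto' hlim hle) zero_le
  exact (eLpNorm_eq_zero_iff h1.1.1 one_ne_zero).1 h0

/-- If the sum of the nonnegative integrals vanished, every weak partial derivative would be zero
a.e., and so would `u`. Positivity allows `‖∇u‖²` to be cancelled and, when `λ₁ > 0`, forces `Δu ≠
0`. -/
lemma MemX.gradNormSq_pos {d : ℕ} (hd : 2 ≤ d) {D : Set (E d)} (hb : Bornology.IsBounded D)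
    {u : E d → ℂ} (h : MemX D u) (hne : IsNontrivial D u) : 0 < gradNormSq D u := by
  refine lt_of_le_of_ne (integral_nonneg fun x => by positivity) fun h0 => hne ?_
  refine h.2.ae_eq_zero hd hb fun i => ?_
  rw [gradNormSq_eq_sum h, eq_comm,
    Finset.sum_eq_zero_iff_of_nonneg fun i _ => integral_nonneg fun x => by positivity] at h0
  have hi := h0 i (Finset.mem_univ i)
  rw [integral_eq_zero_iff_of_nonneg (fun x => by positivity)
    ((h.memLp_weakPartial i).integrable_norm_pow (by norm_num : (2 : ℕ) ≠ 0))] at hi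
  filter_upwards [hi] with x hx
  simpa using hx

/-! ### Pointwise lower bounds for the flux and their integrated form. -/

/-- Completing the square for `1 < n`. -/
lemma re_flux_of_one_lt {m κ : ℝ} (hm : 1 < m) (a b : ℂ) :
    ‖a‖ ^ 2 / m + κ * (a * conj b).re ≤
      (1 / ((m : ℂ) - 1) * (a + κ * m * b) * conj (a + κ * b)).re := by
  have hm1 : 0 < m - 1 := by linarith
  have hm0 : 0 < m := by linarith
  -- The last term is the one discarded; its denominator is positive because `m > 1`.
  have e : (1 / ((m : ℂ) - 1) * (a + κ * m * b) * conj (a + κ * b)).re =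
      ‖a‖ ^ 2 / m + κ * (a * conj b).re + ‖a + κ * m * b‖ ^ 2 / ((m - 1) * m) := by
    have c : (1 / ((m : ℂ) - 1)) = ((1 / (m - 1) : ℝ) : ℂ) := by push_cast; rfl
    rw [c, mul_assoc, Complex.re_ofReal_mul]
    simp only [← Complex.normSq_eq_norm_sq, Complex.normSq_apply, Complex.add_re, Complex.add_im,
      Complex.mul_re, Complex.mul_im, Complex.conj_re, Complex.conj_im, Complex.ofReal_re,
      Complex.ofReal_im]
    field_simp
    ring
  rw [e]
  exact le_add_of_nonneg_right (by positivity)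

/-- Completing the square for `0 ≤ n < 1`. -/
lemma re_flux_of_lt_one {m κ : ℝ} (hm0 : 0 ≤ m) (hm : m < 1) (a b : ℂ) :
    ‖a‖ ^ 2 + κ * (a * conj b).re ≤
      -(1 / ((m : ℂ) - 1) * (a + κ * m * b) * conj (a + κ * b)).re := by
  have hm1 : 0 < 1 - m := by linarith
  -- The overall minus sign compensates `m - 1 < 0`; the discarded last term is nonnegative because
  -- `0 ≤ m < 1`.
  have e : -(1 / ((m : ℂ) - 1) * (a + κ * m * b) * conj (a + κ * b)).re =
      ‖a‖ ^ 2 + κ * (a * conj b).re + m / (1 - m) * ‖a + κ * b‖ ^ 2 := by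
    have c : (1 / ((m : ℂ) - 1)) = ((-(1 / (1 - m)) : ℝ) : ℂ) := by
      rw [← one_div_neg_eq_neg_one_div]; push_cast; ring
    rw [c, mul_assoc, Complex.re_ofReal_mul]
    simp only [← Complex.normSq_eq_norm_sq, Complex.normSq_apply, Complex.add_re, Complex.add_im,
      Complex.mul_re, Complex.mul_im, Complex.conj_re, Complex.conj_im, Complex.ofReal_re,
      Complex.ofReal_im]
    field_simp
    ring
  rw [e]
  exact le_add_of_nonneg_right (by positivity)

/-- The flux is in `L²(D)` if `n` is bounded and bounded away from `1`. -/
lemma MemX.memLp_transmissionFlux {d : ℕ} {D : Set (E d)} {n : E d → ℝ} {u : E d → ℂ} {k : ℂ}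
    (h : MemX D u) (hn_meas : AEMeasurable n (volume.restrict D)) {B δ : ℝ} (hδ : 0 < δ)
    (hB : ∀ᵐ x ∂(volume.restrict D), |n x| ≤ B)
    (hδn : ∀ᵐ x ∂(volume.restrict D), δ ≤ |n x - 1|) :
    MemL2 D (transmissionFlux D n k u) := by
  have hnc : AEMeasurable (fun x => (n x : ℂ)) (volume.restrict D) :=
    Complex.measurable_ofReal.comp_aemeasurable hn_meas
  have hnu : MemL2 D (fun x => k ^ 2 * n x * u x) := by
    have hm : AEStronglyMeasurable (fun x => k ^ 2 * n x * u x) (volume.restrict D) :=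
      AEStronglyMeasurable.mul (f := fun x => k ^ 2 * (n x : ℂ))
        (hnc.const_mul _).aestronglyMeasurable h.1.1.1.1
    refine MemLp.of_le_mul (c := ‖k‖ ^ 2 * B) h.1.1.1 hm ?_
    filter_upwards [hB] with x hx
    rw [norm_mul, norm_mul, norm_pow, Complex.norm_real, Real.norm_eq_abs]
    gcongr
  have hsum : MemL2 D (fun x => laplacian D u x + k ^ 2 * n x * u x) :=
    MemLp.add h.memLp_laplacian hnu
  have hm : AEStronglyMeasurable (transmissionFlux D n k u) (volume.restrict D) :=
    AEStronglyMeasurable.mul (f := fun x => 1 / ((n x : ℂ) - 1))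
      ((hnc.sub_const 1).const_div 1).aestronglyMeasurable hsum.1
  refine MemLp.of_le_mul (c := 1 / δ) hsum hm ?_
  filter_upwards [hδn] with x hx
  have e : ‖(n x : ℂ) - 1‖ = |n x - 1| := by
    rw [← Complex.ofReal_one, ← Complex.ofReal_sub, Complex.norm_real, Real.norm_eq_abs]
  rw [transmissionFlux, norm_mul, norm_div, norm_one, e]
  exact mul_le_mul_of_nonneg_right (one_div_le_one_div_of_le hδ hx) (norm_nonneg _)

/-- Testing the weak trace of the flux with the eigenfunction itself. -/
lemma integral_re_flux_eq {d : ℕ} {D : Set (E d)} {n η : E d → ℝ} {u p : E d → ℂ} {k : ℝ}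
    (hu : MemX D u) (hp : IsNormalDeriv D u p) (hg : MemL2 D (transmissionFlux D n k u))
    (htr : HasWeakTrace D (transmissionFlux D n k u)
      (fun x => -(k : ℂ) ^ 2 * transmissionFlux D n k u x)
      (fun x => -((k : ℂ) ^ 2 / η x) * p x)) :
    ∫ x in D, (transmissionFlux D n k u x *
      conj (laplacian D u x + ((k ^ 2 : ℝ) : ℂ) * u x)).re =
        -(k ^ 2 * ∫ x, ‖p x‖ ^ 2 / η x ∂(surfaceMeasure D)) := by
  have hi : Integrable (fun x => transmissionFlux D n k u x *
      conj (laplacian D u x + ((k ^ 2 : ℝ) : ℂ) * u x)) (volume.restrict D) :=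
    MemLp.integrable_mul hg (MemLp.add hu.memLp_laplacian (hu.1.1.1.const_mul _)).star
  have e1 : ∫ x in D, transmissionFlux D n k u x *
      conj (laplacian D u x + ((k ^ 2 : ℝ) : ℂ) * u x) =
        ∫ x, -((k : ℂ) ^ 2 / η x) * p x * conj (p x) ∂(surfaceMeasure D) := by
    -- The choice `φ = u` turns the term `-φ̄ Δg` into `κ g ū`, which joins `g conj(Δu)` since `κ`
    -- is real.
    rw [← htr u p hu hp]
    congr 1; ext x
    simp only [map_add, map_mul, Complex.conj_ofReal]
    push_cast
    ring
  have e2 : ∫ x, -((k : ℂ) ^ 2 / η x) * p x * conj (p x) ∂(surfaceMeasure D) =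
      ((-(k ^ 2 * ∫ x, ‖p x‖ ^ 2 / η x ∂(surfaceMeasure D)) : ℝ) : ℂ) := by
    rw [← integral_const_mul, ← integral_neg, ← integral_complex_ofReal]
    congr 1; ext x
    rw [mul_assoc, Complex.mul_conj']
    push_cast
    ring
  refine (integral_re hi).trans ?_
  rw [e1, e2]
  exact Complex.ofReal_re _

/-- The integrated form of the lower bounds `re_flux_of_one_lt` and `re_flux_of_lt_one`. -/
lemma MemX.integral_le_of_re_flux {d : ℕ} {D : Set (E d)} {u : E d → ℂ} (hu : MemX D u)
    {c κ : ℝ} {G : E d → ℝ} (hG : Integrable G (volume.restrict D))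
    (h : ∀ᵐ x ∂(volume.restrict D),
      c * ‖laplacian D u x‖ ^ 2 + κ * (laplacian D u x * conj (u x)).re ≤ G x) :
    c * laplacianNormSq D u - κ * gradNormSq D u ≤ ∫ x in D, G x := by
  have i1 := (hu.memLp_laplacian.integrable_norm_pow (by norm_num : (2 : ℕ) ≠ 0)).const_mul c
  have i2 : Integrable (fun x => laplacian D u x * conj (u x)) (volume.restrict D) :=
    MemLp.integrable_mul hu.memLp_laplacian hu.1.1.1.star
  have i3 : Integrable (fun x => κ * (laplacian D u x * conj (u x)).re) (volume.restrict D) :=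
    i2.re.const_mul κ
  -- Green's first identity turns the cross term into `-κ‖∇u‖²`.
  have e : ∫ x in D, (laplacian D u x * conj (u x)).re = -gradNormSq D u := by
    refine (integral_re i2).trans ?_
    rw [hu.integral_laplacian_mul_conj]
    simp
  have := integral_mono_ae (i1.add i3) hG h
  simp only [Pi.add_apply] at this
  rw [integral_add i1 i3, integral_const_mul, integral_const_mul, e] at this
  unfold laplacianNormSq
  linarith

end ConductiveTE

/-! ### The two lower bounds. -/

theorem theorem2p1 {d : ℕ} (hd : d = 2 ∨ d = 3)
    (D : Set (EuclideanSpace ℝ (Fin d))) (hD : IsAdmissibleDomain D)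
    (n η : EuclideanSpace ℝ (Fin d) → ℝ)
    (hn_meas : AEMeasurable n (volume.restrict D))
    (hη_meas : AEMeasurable η (surfaceMeasure D))
    (nmin nmax : ℝ) (hn : ∀ᵐ x ∂(volume.restrict D), nmin ≤ n x ∧ n x ≤ nmax)
    (ηmin ηmax : ℝ) (hηmin : 0 < ηmin)
    (hη : ∀ᵐ x ∂(surfaceMeasure D), ηmin ≤ η x ∧ η x ≤ ηmax)
    (k : ℝ) (hk : IsTransmissionEigenvalue D n η (k : ℂ)) :
    (1 < nmin → firstBucklingEigenvalue D / nmax ≤ k ^ 2) ∧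
    (0 ≤ nmin → nmax < 1 → ∀ CT : ℝ, IsTraceConstant D CT →
      firstBucklingEigenvalue D * ηmin / (ηmin + CT * firstBucklingEigenvalue D) ≤ k ^ 2) := by
  obtain ⟨u, p, hu, hne, hp, -, htr⟩ := hk
  have hgrad : 0 < gradNormSq D u := hu.gradNormSq_pos (by lia) hD.isBounded hne
  have hRay := firstBucklingEigenvalue_mul_le hD.isOpen hu
  set L := firstBucklingEigenvalue D
  have hL : 0 ≤ L := by
    refine Real.sInf_nonneg ?_
    rintro r ⟨φ, -, -, rfl⟩
    exact div_nonneg (integral_nonneg fun x => by positivity)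
      (integral_nonneg fun x => by positivity)
  have hB : ∀ᵐ x ∂(volume.restrict D), |n x| ≤ max |nmin| |nmax| := by
    filter_upwards [hn] with x hx
    exact abs_le_max_abs_abs hx.1 hx.2
  have hG : MemL2 D (transmissionFlux D n k u) → Integrable (fun x =>
      (transmissionFlux D n k u x * conj (laplacian D u x + ((k ^ 2 : ℝ) : ℂ) * u x)).re)
      (volume.restrict D) := fun hg => Integrable.re (MemLp.integrable_mul hg
        (MemLp.add hu.memLp_laplacian (hu.1.1.1.const_mul ((k ^ 2 : ℝ) : ℂ))).star)
  have hcast : ((k ^ 2 : ℝ) : ℂ) = (k : ℂ) ^ 2 := by push_cast; rfl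
  constructor
  · intro h1
    have hg : MemL2 D (transmissionFlux D n k u) :=
      hu.memLp_transmissionFlux hn_meas (sub_pos.2 h1) hB <| by
        filter_upwards [hn] with x hx
        exact (sub_le_sub_right hx.1 1).trans (le_abs_self _)
    -- If `nmax ≤ 0`, the bounds on `n` contradict `1 < nmin` at almost every point, so `D` would be
    -- null and `u` trivial.
    have hnmax : 0 < nmax := by
      by_contra hneg
      refine hne ?_
      filter_upwards [hn] with x hx
      linarith [hx.1, hx.2]
    have key := hu.integral_le_of_re_flux (c := 1 / nmax) (κ := k ^ 2) (hG hg) <| by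
      filter_upwards [hn] with x hx
      have hx1 : 1 < n x := h1.trans_le hx.1
      refine le_trans ?_ (re_flux_of_one_lt (κ := k ^ 2) hx1 (laplacian D u x) (u x) |>.trans_eq
        (by rw [transmissionFlux, hcast]))
      rw [one_div_mul_eq_div]
      gcongr
      exact hx.2
    rw [integral_re_flux_eq hu hp hg htr] at key
    have hbd : 0 ≤ ∫ x, ‖p x‖ ^ 2 / η x ∂(surfaceMeasure D) := by
      refine integral_nonneg_of_ae ?_
      filter_upwards [hη] with x hx
      exact div_nonneg (by positivity) (hηmin.le.trans hx.1)
    have h2 : 1 / nmax * laplacianNormSq D u ≤ k ^ 2 * gradNormSq D u := by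
      linarith [mul_nonneg (sq_nonneg k) hbd]
    refine le_of_mul_le_mul_right (le_trans ?_ h2) hgrad
    rw [div_mul_eq_mul_div, one_div_mul_eq_div]
    gcongr
  · intro h0 h1 CT hCT
    have hg : MemL2 D (transmissionFlux D n k u) :=
      hu.memLp_transmissionFlux hn_meas (sub_pos.2 h1) hB <| by
        filter_upwards [hn] with x hx
        rw [abs_sub_comm]
        exact (sub_le_sub_left hx.2 1).trans (le_abs_self _)
    have key := hu.integral_le_of_re_flux (c := 1) (κ := k ^ 2) (hG hg).neg <| by
      filter_upwards [hn] with x hx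
      refine le_trans (by rw [one_mul]) (re_flux_of_lt_one (κ := k ^ 2) (h0.trans hx.1)
        (hx.2.trans_lt h1) (laplacian D u x) (u x) |>.trans_eq
        (by rw [Pi.neg_apply, transmissionFlux, hcast]))
    simp only [Pi.neg_apply] at key
    rw [integral_neg, integral_re_flux_eq hu hp hg htr, neg_neg, one_mul] at key
    have hbd : ∫ x, ‖p x‖ ^ 2 / η x ∂(surfaceMeasure D) ≤
        (∫ x, ‖p x‖ ^ 2 ∂(surfaceMeasure D)) / ηmin := by
      rw [← integral_div]
      refine integral_mono_of_nonneg ?_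
        ((hp.1.integrable_norm_pow (by norm_num : (2 : ℕ) ≠ 0)).div_const ηmin) ?_
      · filter_upwards [hη] with x hx
        exact div_nonneg (by positivity) (hηmin.le.trans hx.1)
      · filter_upwards [hη] with x hx
        exact div_le_div_of_nonneg_left (by positivity) hηmin hx.1
    have hT := hCT u p hu hp
    have hP : 0 ≤ ∫ x, ‖p x‖ ^ 2 ∂(surfaceMeasure D) := integral_nonneg fun x => by positivity
    have hk2 := sq_nonneg k
    set P := ∫ x, ‖p x‖ ^ 2 ∂(surfaceMeasure D)
    set A := laplacianNormSq D u
    have key2 : A ≤ k ^ 2 * gradNormSq D u + k ^ 2 * (CT * A / ηmin) := by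
      have : k ^ 2 * ∫ x, ‖p x‖ ^ 2 / η x ∂(surfaceMeasure D) ≤ k ^ 2 * (CT * A / ηmin) := by
        gcongr
        exact hbd.trans (by gcongr)
      linarith
    -- Only `λ₁ ≥ 0` is known so far. For `λ₁ = 0` the numerator vanishes and the bound reads `0 ≤
    -- k²`.
    rcases hL.eq_or_lt with hL0 | hL0
    · rw [← hL0]
      simpa using hk2
    have hA : 0 < A := (mul_pos hL0 hgrad).trans_le hRay
    -- No sign of `CT` is assumed: it follows from `0 ≤ ‖∂_ν u‖² ≤ CT ‖Δu‖²` with `Δu ≠ 0`, and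
    -- makes the denominator positive.
    have hC : 0 ≤ CT := nonneg_of_mul_nonneg_left (hP.trans hT) hA
    rw [div_le_iff₀ (by positivity)]
    refine le_of_mul_le_mul_right ?_ hA
    -- Multiply `key2` by `λ₁ ηmin`, apply the Rayleigh bound to `λ₁‖∇u‖²`, and cancel `A = ‖Δu‖²`.
    calc L * ηmin * A ≤ L * ηmin * (k ^ 2 * gradNormSq D u + k ^ 2 * (CT * A / ηmin)) := by gcongr
      _ = ηmin * k ^ 2 * (L * gradNormSq D u) + k ^ 2 * (CT * L) * A := by field_simp
      _ ≤ ηmin * k ^ 2 * A + k ^ 2 * (CT * L) * A := by gcongr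
      _ = k ^ 2 * (ηmin + CT * L) * A := by ring
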